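/- Let $j\in\{0,\tfrac12,1,\tfrac32,\dots\}$, let $J_x,J_y,J_z$ be the angular momentum operators on the $(2j+1)$-dimensional Hilbert space of a spin-$j$ system, and for a unit vector $\hat n\in\mathbb R^3$ put $J_{\hat n}=n_xJ_x+n_yJ_y+n_zJ_z$. Let $\xi$ be any complex-linear map on the operators of this space that is rotationally invariant, i.e. $\xi(R\rho R^\dagger)=R\,\xi(\rho)R^\dagger$ for every operator $\rho$ and every rotation operator $R=e^{-i\theta J_{\hat m}}$ ($\theta\in\mathbb R$, $\hat m$ a unit vector), that is, for every operator $R=R_j(\Omega)$, $\Omega\in SU(2)$, of the spin-$j$ irreducible representation. Then there are coefficients $A_i^{(\ell)}\in\mathbb C$ ($\ell,i\ge 0$), depending only on $j$ and $\xi$, which can be chosen real if $\xi$ maps Hermitian operators to Hermitian operators (in particular if $\xi$ is a positive map, such as a quantum operation), with the following property. For every unit vector $\hat n$, every sequence of operators (in particular, of density operators) $\rho^{(0)},\rho^{(1)},\dots$ with $\rho^{(k)}=\xi(\rho^{(k-1)})$ for $k\ge1$, every $k\ge 1$ and every integer $\ell\ge0$: if $\ell$ is even, then $$\mathrm{Tr}\big[\rho^{(k)}J_{\hat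 n}^{\ell}\big]=\sum_{i=0}^{\ell/2}A_{2i}^{(\ell)}\,\mathrm{Tr}\big[\rho^{(k-1)}J_{\hat n}^{2i}\big],$$ and if $\ell$ is odd, then $$\mathrm{Tr}\big[\rho^{(k)}J_{\hat n}^{\ell}\big]=\sum_{i=1}^{(\ell+1)/2}A_{2i-1}^{(\ell)}\,\mathrm{Tr}\big[\rho^{(k-1)}J_{\hat n}^{2i-1}\big].$$ -/

import Mathlib

open scoped Matrix

noncomputable section

/-- Operators on the spin-`j` Hilbert space, where `N = 2j` and the dimension is `N + 1 = 2j + 1`.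
The index `a : Fin (N + 1)` stands for the basis vector `|j, m⟩` with `m = j - a`. -/
abbrev SpinOp (N : ℕ) : Type := Matrix (Fin (N + 1)) (Fin (N + 1)) ℂ

/-- The magnetic quantum number `m = j - a` of the basis vector with index `a`. -/
def magneticNumber (N : ℕ) (a : Fin (N + 1)) : ℝ := (N : ℝ) / 2 - (a : ℕ)

/-- The operator `J_z`, with `J_z |j, m⟩ = m |j, m⟩`. -/
def spinZ (N : ℕ) : SpinOp N := Matrix.diagonal fun a => (magneticNumber N a : ℂ)

/-- The raising operator `J_+`, with
`J_+ |j, m⟩ = sqrt (j (j + 1) - m (m + 1)) |j, m + 1⟩`. -/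
def spinRaise (N : ℕ) : SpinOp N := Matrix.of fun a b =>
  if (a : ℕ) + 1 = b then
    (Real.sqrt ((N : ℝ) / 2 * ((N : ℝ) / 2 + 1)
      - magneticNumber N b * (magneticNumber N b + 1)) : ℂ)
  else 0

/-- The operator `J_x = (J_+ + J_-) / 2`, where `J_-` is the adjoint of `J_+`. -/
def spinX (N : ℕ) : SpinOp N := (1 / 2 : ℂ) • (spinRaise N + (spinRaise N)ᴴ)

/-- The operator `J_y = (J_+ - J_-) / (2 i)`. -/
def spinY (N : ℕ) : SpinOp N := (1 / (2 * Complex.I) : ℂ) • (spinRaise N - (spinRaise N)ᴴ)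

/-- The angular momentum operator `J_n = n_x J_x + n_y J_y + n_z J_z` along the vector `n`. -/
def spinAlong (N : ℕ) (n : EuclideanSpace ℝ (Fin 3)) : SpinOp N :=
  (n 0 : ℂ) • spinX N + (n 1 : ℂ) • spinY N + (n 2 : ℂ) • spinZ N

/-- The operator `R_n(θ) = exp (-i θ J_n)` of the rotation by the angle `θ` around `n`. Over all
unit vectors `n` and all real `θ`, these are exactly the operators `R_j(Ω)`, `Ω ∈ SU(2)`, of the
spin-`j` irreducible unitary representation, as every element of `SU(2)` is of the form
`exp (-i θ n·σ / 2)`. -/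
def spinRotation (N : ℕ) (n : EuclideanSpace ℝ (Fin 3)) (θ : ℝ) : SpinOp N :=
  NormedSpace.exp ((-(Complex.I * (θ : ℂ))) • spinAlong N n)

/-- A linear map `ξ` on operators is rotationally invariant if `ξ (R ρ R†) = R (ξ ρ) R†` for every
rotation operator `R` of the spin-`j` representation. -/
def RotationallyInvariant (N : ℕ) (ξ : SpinOp N →ₗ[ℂ] SpinOp N) : Prop :=
  ∀ n : EuclideanSpace ℝ (Fin 3), ‖n‖ = 1 → ∀ (θ : ℝ) (ρ : SpinOp N),
    ξ (spinRotation N n θ * ρ * (spinRotation N n θ)ᴴ)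
      = spinRotation N n θ * ξ ρ * (spinRotation N n θ)ᴴ

/-- The map `ξ` sends Hermitian operators to Hermitian operators. Every positive map, hence every
quantum operation, has this property. -/
def HermitianPreserving (N : ℕ) (ξ : SpinOp N →ₗ[ℂ] SpinOp N) : Prop :=
  ∀ ρ : SpinOp N, ρ.IsHermitian → (ξ ρ).IsHermitian

/-- The moment `Tr[ρ J_n ^ ℓ]`. -/
def moment (N : ℕ) (n : EuclideanSpace ℝ (Fin 3)) (ρ : SpinOp N) (ℓ : ℕ) : ℂ :=
  (ρ * spinAlong N n ^ ℓ).trace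

end

/-!
In the Heisenberg picture `Tr[ξ ρ X] = Tr[ρ (ξ* X)]`, where the dual map `ξ*` (`traceDual`) is
again rotationally invariant, and it is enough to expand `ξ* (J_n ^ ℓ)` in powers of `J_n`, with
coefficients that do not depend on `n`. Every `J_n` is a rotated `J_z`
(`exists_spinRotation_mul_spinZ_eq_spinAlong`), so only `n = e_z` matters.

Differentiating the invariance at the identity shows that `ξ*` commutes with `[J_z, ·]` and
`[J_+, ·]`. As `J_z ^ ℓ` commutes with `J_z`, so does its image, which is therefore diagonal, say
with entries `f 0, …, f N`. On diagonal operators `[J_+, ·] ^ k` is the `k`-th forward difference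
followed by multiplication by `J_+ ^ k` (`ad_spinRaise_pow_diagonal`). Hence `[J_+, ·] ^ (ℓ + 1)`
annihilates `J_z ^ ℓ`, and so its image, and the forward differences of `f` at `0` of order above
`ℓ` vanish. By Newton's interpolation formula the image is a polynomial in `J_z` of degree at most
`ℓ` (`RotationallyInvariant.exists_map_spinZ_pow`).

A half-turn around a horizontal axis takes `J_z` to `-J_z`, so the terms of the wrong parity can
be dropped (`RotationallyInvariant.map_spinZ_pow_parity`). If `ξ`, and hence `ξ*`, preserves
Hermitian operators, the values of the polynomial at the real eigenvalues of `J_z` are real, and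
the coefficients can be replaced by their real parts (`eq_sum_re_smul_spinZ_pow`).
-/

open scoped Matrix

/-! ### Conjugation by one-parameter groups -/

section BanachAlgebra

variable {𝔸 : Type*} [NormedRing 𝔸] [NormedAlgebra ℝ 𝔸] [CompleteSpace 𝔸]

theorem hasDerivAt_exp_smul_mul_mul_exp_neg_smul (A B : 𝔸) :
    HasDerivAt (fun t : ℝ => NormedSpace.exp (t • A) * B * NormedSpace.exp (-(t • A)))
      (A * B - B * A) 0 := by
  have h1 := hasDerivAt_exp_smul_const (𝕂 := ℝ) A 0
  have h2 := hasDerivAt_exp_smul_const (𝕂 := ℝ) (-A) 0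
  have h := (h1.mul_const B).fun_mul h2
  simpa [sub_eq_add_neg] using h

/-- If `[A, B] = C` and `[A, C] = -B`, conjugation by `exp (t A)` rotates the plane spanned by `B`
and `C` by the angle `t`. -/
theorem exp_smul_mul_mul_exp_neg_smul_eq_rotation {A B C : 𝔸} (hB : A * B - B * A = C)
    (hC : A * C - C * A = -B) (t : ℝ) :
    NormedSpace.exp (t • A) * B * NormedSpace.exp (-(t • A))
      = Real.cos t • B + Real.sin t • C := by
  let _ : NormedAlgebra ℚ 𝔸 := NormedAlgebra.restrictScalars ℚ ℝ 𝔸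
  -- The rotated vector, conjugated back, does not depend on the angle.
  set G : ℝ → 𝔸 := fun s => NormedSpace.exp (s • (-A)) * (Real.cos s • B + Real.sin s • C)
    * NormedSpace.exp (s • A) with hG
  have hd : ∀ s, HasDerivAt G 0 s := by
    intro s
    have h1 := hasDerivAt_exp_smul_const (𝕂 := ℝ) (-A) s
    have h2 := hasDerivAt_exp_smul_const' (𝕂 := ℝ) A s
    have h3 := ((Real.hasDerivAt_cos s).smul_const B).fun_add ((Real.hasDerivAt_sin s).smul_const C)
    have h := (h1.fun_mul h3).fun_mul h2
    convert! h using 1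
    have key : -A * (Real.cos s • B + Real.sin s • C) + (-Real.sin s • B + Real.cos s • C)
        + (Real.cos s • B + Real.sin s • C) * A = 0 := by
      have e : A * (Real.cos s • B + Real.sin s • C) - (Real.cos s • B + Real.sin s • C) * A
          = Real.cos s • C + Real.sin s • (-B) := by
        nth_rewrite 3 [← hB]
        rw [← hC]
        simp only [mul_add, add_mul, mul_smul_comm, smul_mul_assoc, smul_sub]
        abel
      rw [neg_mul, add_right_comm, ← sub_eq_neg_add, ← neg_sub, e]
      simp only [neg_smul, smul_neg]
      abel
    symm
    calc _ = NormedSpace.exp (s • (-A)) * (-A * (Real.cos s • B + Real.sin s • C)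
          + (-Real.sin s • B + Real.cos s • C)
          + (Real.cos s • B + Real.sin s • C) * A) * NormedSpace.exp (s • A) := by
          simp only [mul_add, add_mul, mul_assoc]
      _ = 0 := by rw [key]; simp
  have hconst : G t = G 0 := is_const_of_deriv_eq_zero (fun s => (hd s).differentiableAt)
    (fun s => (hd s).deriv) t 0
  have hG0 : G 0 = B := by simp [hG]
  have hcomm : Commute (t • A) (-(t • A)) := (Commute.refl _).neg_right
  have e1 : NormedSpace.exp (t • A) * NormedSpace.exp (-(t • A)) = 1 := by
    rw [← NormedSpace.exp_add_of_commute hcomm, add_neg_cancel, NormedSpace.exp_zero]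
  calc _ = NormedSpace.exp (t • A) * G t * NormedSpace.exp (-(t • A)) := by rw [hconst, hG0]
    _ = (NormedSpace.exp (t • A) * NormedSpace.exp (-(t • A)))
        * (Real.cos t • B + Real.sin t • C)
        * (NormedSpace.exp (t • A) * NormedSpace.exp (-(t • A))) := by
        simp only [hG, smul_neg, mul_assoc]
    _ = _ := by rw [e1, one_mul, mul_one]

end BanachAlgebra

/-! ### Newton interpolation -/

open Polynomial in
/-- A function on `{0, …, N}` whose forward differences at `0` of order above `ℓ` vanish is a
polynomial of degree at most `ℓ`, here written in the variable `c - a`. -/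
theorem exists_polynomial_of_fwdDiff_iter_eq_zero (N ℓ : ℕ) (c : ℂ) (f : ℕ → ℂ)
    (h : ∀ k, ℓ < k → k ≤ N → (fwdDiff 1)^[k] f 0 = 0) :
    ∃ p : ℂ[X], p.natDegree < ℓ + 1 ∧ ∀ a ≤ N, f a = p.eval (c - a) := by
  refine ⟨∑ k ∈ Finset.range (ℓ + 1),
    C ((fwdDiff 1)^[k] f 0 / k.factorial) * (descPochhammer ℂ k).comp (C c - X), ?_, ?_⟩
  · refine Nat.lt_succ_of_le (natDegree_sum_le_of_forall_le _ _ fun k hk => ?_)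
    refine (natDegree_C_mul_le _ _).trans ?_
    rw [natDegree_comp]
    have h1 : (C c - X : ℂ[X]).natDegree ≤ 1 := by compute_degree
    have h2 : (descPochhammer ℂ k).natDegree = k := descPochhammer_natDegree ℂ k
    rw [h2]
    have := Finset.mem_range.1 hk
    nlinarith
  · intro a ha
    have hN := shift_eq_sum_fwdDiff_iter (1 : ℕ) f a 0
    simp only [smul_eq_mul, mul_one, zero_add] at hN
    rw [hN, eval_finsetSum]
    -- Both sums may be extended to a common range, the added terms being zero.
    have e1 : ∑ k ∈ Finset.range (a + 1), a.choose k • (fwdDiff 1)^[k] f 0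
        = ∑ k ∈ Finset.range (a + 1 + (ℓ + 1)), a.choose k • (fwdDiff 1)^[k] f 0 := by
      refine Finset.sum_subset (Finset.range_mono (by omega)) fun k _ hk => ?_
      rw [Nat.choose_eq_zero_of_lt (by simpa using hk), zero_smul]
    have e2 : ∑ k ∈ Finset.range (ℓ + 1), a.choose k • (fwdDiff 1)^[k] f 0
        = ∑ k ∈ Finset.range (a + 1 + (ℓ + 1)), a.choose k • (fwdDiff 1)^[k] f 0 := by
      refine Finset.sum_subset (Finset.range_mono (by omega)) fun k _ hk => ?_
      rcases le_or_gt k N with hkN | hkN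
      · rw [h k (by simpa using hk) hkN, smul_zero]
      · rw [Nat.choose_eq_zero_of_lt (by omega), zero_smul]
    rw [e1, ← e2]
    refine Finset.sum_congr rfl fun k _ => ?_
    simp only [eval_mul, eval_C, eval_comp, eval_sub, eval_X, sub_sub_cancel, nsmul_eq_mul]
    rw [Nat.cast_choose_eq_descPochhammer_div]
    ring

open Polynomial in
theorem fwdDiff_iter_natCast_pow_eq_zero (c : ℂ) (ℓ : ℕ) :
    (fwdDiff 1)^[ℓ + 1] (fun a : ℕ => (c - a) ^ ℓ) = 0 := by
  have hP : ((C c - X : ℂ[X]) ^ ℓ).natDegree < ℓ + 1 := by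
    refine Nat.lt_succ_of_le ?_
    compute_degree
  have h := Polynomial.fwdDiff_iter_eq_zero_of_degree_lt hP
  funext y
  have hy := congrFun h (y : ℂ)
  rw [fwdDiff_iter_eq_sum_shift] at hy ⊢
  simpa using hy

/-! ### The angular momentum algebra -/

theorem spinRaise_apply (N : ℕ) (a b : Fin (N + 1)) :
    spinRaise N a b = if (a : ℕ) + 1 = b then (Real.sqrt ((a + 1) * (N - a)) : ℂ) else 0 := by
  simp only [spinRaise, Matrix.of_apply]
  split_ifs with h
  · have hb : ((b : ℕ) : ℝ) = a + 1 := by exact_mod_cast h.symm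
    congr 2
    simp only [magneticNumber, hb]
    ring
  · rfl

theorem spinRaise_mul_conjTranspose (N : ℕ) :
    spinRaise N * (spinRaise N)ᴴ
      = Matrix.diagonal fun a : Fin (N + 1) => (((a : ℕ) + 1) * ((N : ℂ) - (a : ℕ))) := by
  ext a c
  simp only [Matrix.mul_apply, Matrix.conjTranspose_apply, spinRaise_apply, Matrix.diagonal_apply]
  split_ifs with hac
  · subst hac
    rcases Nat.lt_or_ge a N with ha | ha
    · rw [Finset.sum_eq_single (⟨a + 1, by omega⟩ : Fin (N + 1))]
      · have h0 : (0 : ℝ) ≤ (a + 1) * (N - a) :=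
          mul_nonneg (by positivity) (sub_nonneg.2 (by exact_mod_cast ha.le))
        simp only [if_true, RCLike.star_def, Complex.conj_ofReal, ← Complex.ofReal_mul,
          Real.mul_self_sqrt h0]
        push_cast
        rfl
      · intro b _ hb
        rw [if_neg (fun h => hb (Fin.ext h.symm)), zero_mul]
      · simp
    · -- the highest index has no successor, and its diagonal entry vanishes
      have hN : (a : ℕ) = N := by omega
      rw [Finset.sum_eq_zero, hN, sub_self, mul_zero]
      intro b _
      rw [if_neg (by omega), zero_mul]
  · refine Finset.sum_eq_zero fun b _ => ?_
    by_cases h1 : (a : ℕ) + 1 = b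
    · rw [if_neg (c := (c : ℕ) + 1 = b) (by omega)]
      simp
    · rw [if_neg h1, zero_mul]

theorem conjTranspose_mul_spinRaise (N : ℕ) :
    (spinRaise N)ᴴ * spinRaise N
      = Matrix.diagonal fun a : Fin (N + 1) => (((a : ℕ) : ℂ) * ((N : ℂ) + 1 - (a : ℕ))) := by
  ext a c
  simp only [Matrix.mul_apply, Matrix.conjTranspose_apply, spinRaise_apply, Matrix.diagonal_apply]
  split_ifs with hac
  · subst hac
    rcases Nat.eq_zero_or_pos a with ha | ha
    · rw [Finset.sum_eq_zero, ha, Nat.cast_zero, zero_mul]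
      intro b _
      rw [if_neg (by omega), star_zero, zero_mul]
    · obtain ⟨d, hd⟩ : ∃ d : Fin (N + 1), (d : ℕ) + 1 = a := ⟨⟨a - 1, by omega⟩, by simp; omega⟩
      rw [Finset.sum_eq_single d]
      · have h0 : (0 : ℝ) ≤ (d + 1) * (N - d) :=
          mul_nonneg (by positivity) (sub_nonneg.2 (by exact_mod_cast (by omega : (d : ℕ) ≤ N)))
        simp only [hd, if_true, RCLike.star_def, Complex.conj_ofReal, ← Complex.ofReal_mul,
          Real.mul_self_sqrt h0]
        rw [← hd]
        push_cast
        ring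
      · intro b _ hb
        rw [if_neg (fun h => hb (Fin.ext (by omega))), star_zero, zero_mul]
      · simp
  · refine Finset.sum_eq_zero fun b _ => ?_
    by_cases h1 : (b : ℕ) + 1 = a
    · rw [if_neg (c := (b : ℕ) + 1 = c) (by omega), mul_zero]
    · rw [if_neg h1, star_zero, zero_mul]

theorem spinRaise_commutator_conjTranspose (N : ℕ) :
    spinRaise N * (spinRaise N)ᴴ - (spinRaise N)ᴴ * spinRaise N = (2 : ℂ) • spinZ N := by
  rw [spinRaise_mul_conjTranspose, conjTranspose_mul_spinRaise, spinZ, Matrix.diagonal_sub,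
    ← Matrix.diagonal_smul]
  congr 1
  ext a
  simp [magneticNumber]
  ring

theorem spinZ_commutator_spinRaise (N : ℕ) :
    spinZ N * spinRaise N - spinRaise N * spinZ N = spinRaise N := by
  ext a b
  rw [spinZ, Matrix.sub_apply, Matrix.diagonal_mul, Matrix.mul_diagonal, spinRaise_apply]
  split_ifs with h
  · have hb : ((b : ℕ) : ℂ) = a + 1 := by exact_mod_cast h.symm
    simp only [magneticNumber]
    push_cast
    rw [hb]
    ring
  · simp

theorem isHermitian_spinZ (N : ℕ) : (spinZ N).IsHermitian := by
  simp [Matrix.IsHermitian, spinZ, Matrix.diagonal_conjTranspose, Pi.star_def]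

theorem spinZ_commutator_conjTranspose (N : ℕ) :
    spinZ N * (spinRaise N)ᴴ - (spinRaise N)ᴴ * spinZ N = -(spinRaise N)ᴴ := by
  have h := congrArg Matrix.conjTranspose (spinZ_commutator_spinRaise N)
  rw [Matrix.conjTranspose_sub, Matrix.conjTranspose_mul, Matrix.conjTranspose_mul,
    (isHermitian_spinZ N).eq] at h
  nth_rewrite 3 [← h]
  rw [neg_sub]

theorem spinX_add_I_smul_spinY (N : ℕ) : spinX N + Complex.I • spinY N = spinRaise N := by
  simp only [spinX, spinY, smul_smul]
  have : Complex.I * (1 / (2 * Complex.I)) = 1 / 2 := by field_simp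
  rw [this]
  module

theorem spinX_commutator_spinZ (N : ℕ) :
    spinX N * spinZ N - spinZ N * spinX N = (-Complex.I) • spinY N := by
  have h1 := spinZ_commutator_spinRaise N
  have h2 := spinZ_commutator_conjTranspose N
  have : -Complex.I * (1 / (2 * Complex.I)) = -(1 / 2) := by field_simp
  rw [spinX, spinY, smul_smul, this]
  calc _ = -(1 / 2 : ℂ) • ((spinZ N * spinRaise N - spinRaise N * spinZ N)
        + (spinZ N * (spinRaise N)ᴴ - (spinRaise N)ᴴ * spinZ N)) := by
        simp only [smul_mul_assoc, mul_smul_comm, add_mul, mul_add]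
        module
    _ = _ := by rw [h1, h2, sub_eq_add_neg]

theorem spinY_commutator_spinZ (N : ℕ) :
    spinY N * spinZ N - spinZ N * spinY N = Complex.I • spinX N := by
  have h1 := spinZ_commutator_spinRaise N
  have h2 := spinZ_commutator_conjTranspose N
  have : 1 / (2 * Complex.I) = Complex.I * (-(1 / 2)) := by
    field_simp
    simp
  rw [spinX, spinY, this]
  calc _ = (Complex.I * (1 / 2) : ℂ) • ((spinZ N * spinRaise N - spinRaise N * spinZ N)
        - (spinZ N * (spinRaise N)ᴴ - (spinRaise N)ᴴ * spinZ N)) := by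
        simp only [smul_mul_assoc, mul_smul_comm, sub_mul, mul_sub]
        module
    _ = _ := by rw [h1, h2, sub_neg_eq_add, smul_smul]

theorem spinX_commutator_spinY (N : ℕ) :
    spinX N * spinY N - spinY N * spinX N = Complex.I • spinZ N := by
  have h := spinRaise_commutator_conjTranspose N
  have : 1 / (2 * Complex.I) = -(Complex.I / 2) := by
    field_simp
    simp
  rw [spinX, spinY, this]
  calc _ = (Complex.I / 2) • (spinRaise N * (spinRaise N)ᴴ - (spinRaise N)ᴴ * spinRaise N) := by
        simp only [smul_mul_assoc, mul_smul_comm, sub_mul, mul_sub, add_mul, mul_add]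
        module
    _ = _ := by rw [h, smul_smul, div_mul_cancel₀ _ two_ne_zero]

theorem isHermitian_spinAlong (N : ℕ) (n : EuclideanSpace ℝ (Fin 3)) :
    (spinAlong N n).IsHermitian := by
  have hX : (spinX N)ᴴ = spinX N := by
    simp [spinX, Matrix.conjTranspose_smul, Matrix.conjTranspose_add, add_comm]
  have hY : (spinY N)ᴴ = spinY N := by
    simp only [spinY, Matrix.conjTranspose_smul, Matrix.conjTranspose_sub,
      Matrix.conjTranspose_conjTranspose]
    rw [← neg_sub, smul_neg, ← neg_smul]
    simp
  rw [Matrix.IsHermitian, spinAlong]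
  simp only [Matrix.conjTranspose_add, Matrix.conjTranspose_smul, hX, hY,
    (isHermitian_spinZ N).eq, RCLike.star_def, Complex.conj_ofReal]

/-! ### Rotation operators -/

theorem spinRotation_eq_exp_smul (N : ℕ) (n : EuclideanSpace ℝ (Fin 3)) (θ : ℝ) :
    spinRotation N n θ = NormedSpace.exp (θ • ((-Complex.I) • spinAlong N n)) := by
  rw [spinRotation, ← Complex.coe_smul, smul_smul]
  congr 2
  ring

theorem conjTranspose_spinRotation (N : ℕ) (n : EuclideanSpace ℝ (Fin 3)) (θ : ℝ) :
    (spinRotation N n θ)ᴴ = NormedSpace.exp (-(θ • ((-Complex.I) • spinAlong N n))) := by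
  rw [spinRotation_eq_exp_smul, ← Matrix.exp_conjTranspose, Matrix.conjTranspose_smul,
    Matrix.conjTranspose_smul, (isHermitian_spinAlong N n).eq]
  simp

theorem conjTranspose_spinRotation_eq_neg (N : ℕ) (n : EuclideanSpace ℝ (Fin 3)) (θ : ℝ) :
    (spinRotation N n θ)ᴴ = spinRotation N n (-θ) := by
  rw [conjTranspose_spinRotation, spinRotation_eq_exp_smul, neg_smul θ]

theorem conjTranspose_mul_spinRotation (N : ℕ) (n : EuclideanSpace ℝ (Fin 3)) (θ : ℝ) :
    (spinRotation N n θ)ᴴ * spinRotation N n θ = 1 := by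
  rw [conjTranspose_spinRotation, spinRotation_eq_exp_smul, ← Matrix.exp_add_of_commute,
    neg_add_cancel, NormedSpace.exp_zero]
  exact (Commute.refl _).neg_left

open scoped Matrix.Norms.Operator in
/-- The rotation around a horizontal axis `m` takes `J_z` to `J_n` with
`n = cos θ e_z + sin θ (m × e_z)`. -/
theorem spinRotation_mul_spinZ_mul_conjTranspose (N : ℕ) (a b θ : ℝ) (hab : a ^ 2 + b ^ 2 = 1) :
    spinRotation N !₂[a, b, 0] θ * spinZ N * (spinRotation N !₂[a, b, 0] θ)ᴴ
      = spinAlong N !₂[Real.sin θ * b, -(Real.sin θ * a), Real.cos θ] := by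
  have hx := spinX_commutator_spinZ N
  have hy := spinY_commutator_spinZ N
  have hxy := spinX_commutator_spinY N
  set A : SpinOp N := (-Complex.I) • spinAlong N !₂[a, b, 0] with hA
  have hA' : A = (-Complex.I * a) • spinX N + (-Complex.I * b) • spinY N := by
    simp [hA, spinAlong, mul_smul]
  have hAB : A * spinZ N - spinZ N * A = (b : ℂ) • spinX N - (a : ℂ) • spinY N := by
    calc _ = (-Complex.I * a) • (spinX N * spinZ N - spinZ N * spinX N)
          + (-Complex.I * b) • (spinY N * spinZ N - spinZ N * spinY N) := by
          rw [hA']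
          simp only [smul_mul_assoc, mul_smul_comm, add_mul, mul_add]
          module
      _ = (Complex.I * Complex.I * a) • spinY N - (Complex.I * Complex.I * b) • spinX N := by
          rw [hx, hy]
          module
      _ = _ := by
          rw [Complex.I_mul_I]
          module
  have hAC : A * ((b : ℂ) • spinX N - (a : ℂ) • spinY N)
      - ((b : ℂ) • spinX N - (a : ℂ) • spinY N) * A = -spinZ N := by
    have hab' : (a : ℂ) ^ 2 + (b : ℂ) ^ 2 = 1 := by exact_mod_cast hab
    calc _ = (Complex.I * ((a : ℂ) ^ 2 + (b : ℂ) ^ 2)) •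
          (spinX N * spinY N - spinY N * spinX N) := by
          rw [hA']
          simp only [smul_mul_assoc, mul_smul_comm, add_mul, mul_add, sub_mul, mul_sub]
          module
      _ = _ := by
          rw [hab', hxy, smul_smul, mul_one, Complex.I_mul_I, neg_one_smul]
  rw [conjTranspose_spinRotation, spinRotation_eq_exp_smul]
  refine (exp_smul_mul_mul_exp_neg_smul_eq_rotation hAB hAC θ).trans ?_
  simp only [spinAlong, ← Complex.coe_smul]
  simp
  module

/-- Every `J_n` is a rotated `J_z`. -/
theorem exists_spinRotation_mul_spinZ_eq_spinAlong (N : ℕ) (n : EuclideanSpace ℝ (Fin 3))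
    (hn : ‖n‖ = 1) :
    ∃ (m : EuclideanSpace ℝ (Fin 3)) (θ : ℝ), ‖m‖ = 1 ∧
      spinRotation N m θ * spinZ N * (spinRotation N m θ)ᴴ = spinAlong N n := by
  have hn2 : n 0 ^ 2 + n 1 ^ 2 + n 2 ^ 2 = 1 := by
    have h := EuclideanSpace.real_norm_sq_eq n
    rw [hn, Fin.sum_univ_three] at h
    linarith
  obtain ⟨a, b, θ, hab, h0, h1, h2⟩ : ∃ a b θ : ℝ, a ^ 2 + b ^ 2 = 1 ∧
      Real.sin θ * b = n 0 ∧ -(Real.sin θ * a) = n 1 ∧ Real.cos θ = n 2 := by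
    have hc : Real.cos (Real.arccos (n 2)) = n 2 :=
      Real.cos_arccos (by nlinarith [sq_nonneg (n 0), sq_nonneg (n 1)])
        (by nlinarith [sq_nonneg (n 0), sq_nonneg (n 1)])
    have hs := Real.sin_sq_add_cos_sq (Real.arccos (n 2))
    rw [hc] at hs
    rcases eq_or_ne (Real.sin (Real.arccos (n 2))) 0 with h | h
    · -- `n = ± e_z`, and any horizontal axis will do
      rw [h] at hs
      refine ⟨1, 0, Real.arccos (n 2), by norm_num, ?_, ?_, hc⟩ <;> rw [h]
      · nlinarith [sq_nonneg (n 0), sq_nonneg (n 1)]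
      · nlinarith [sq_nonneg (n 0), sq_nonneg (n 1)]
    · refine ⟨-(n 1 / Real.sin (Real.arccos (n 2))), n 0 / Real.sin (Real.arccos (n 2)),
        Real.arccos (n 2), ?_, mul_div_cancel₀ _ h, ?_, hc⟩
      · field_simp
        linarith
      · rw [mul_neg, neg_neg, mul_div_cancel₀ _ h]
  refine ⟨!₂[a, b, 0], θ, ?_, ?_⟩
  · rw [← sq_eq_sq₀ (norm_nonneg _) zero_le_one, EuclideanSpace.real_norm_sq_eq,
      Fin.sum_univ_three]
    simpa using hab
  · rw [spinRotation_mul_spinZ_mul_conjTranspose N a b θ hab]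
    congr 1
    ext i
    fin_cases i
    · exact h0
    · exact h1
    · exact h2

/-! ### Rotationally invariant maps and their duals -/

/-- The dual (Heisenberg picture) of a linear map `ξ` on operators, with respect to the bilinear
pairing `(ρ, X) ↦ Tr[ρ X]`: it satisfies `Tr[ξ ρ X] = Tr[ρ (traceDual N ξ X)]`. -/
noncomputable def traceDual (N : ℕ) (ξ : SpinOp N →ₗ[ℂ] SpinOp N) : SpinOp N →ₗ[ℂ] SpinOp N where
  toFun X := Matrix.of fun b a => (ξ (Matrix.single a b 1) * X).trace
  map_add' X Y := by
    ext b a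
    simp [mul_add]
  map_smul' c X := by
    ext b a
    simp

theorem trace_mul_traceDual {N : ℕ} (ξ : SpinOp N →ₗ[ℂ] SpinOp N) (ρ X : SpinOp N) :
    (ρ * traceDual N ξ X).trace = (ξ ρ * X).trace := by
  induction ρ using Matrix.induction_on' with
  | h_zero => simp
  | h_add p q hp hq => simp only [add_mul, map_add, Matrix.trace_add, hp, hq]
  | h_std_basis a b c =>
    have h : Matrix.single a b c = c • Matrix.single a b (1 : ℂ) := by simp
    rw [h, map_smul, smul_mul_assoc, smul_mul_assoc, Matrix.trace_smul, Matrix.trace_smul,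
      Matrix.trace_single_mul, one_smul]
    rfl

theorem RotationallyInvariant.traceDual {N : ℕ} {ξ : SpinOp N →ₗ[ℂ] SpinOp N}
    (hξ : RotationallyInvariant N ξ) : RotationallyInvariant N (traceDual N ξ) := by
  intro n hn θ X
  refine Matrix.ext_iff_trace_mul_left.2 fun ρ => ?_
  have h := hξ n hn (-θ) ρ
  rw [← conjTranspose_spinRotation_eq_neg, Matrix.conjTranspose_conjTranspose] at h
  set R := spinRotation N n θ
  calc (ρ * _root_.traceDual N ξ (R * X * Rᴴ)).trace
      = (Rᴴ * (ξ ρ * (R * X))).trace := by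
        rw [trace_mul_traceDual, Matrix.trace_mul_comm Rᴴ]
        simp only [mul_assoc]
    _ = (Rᴴ * ξ ρ * R * X).trace := by simp only [mul_assoc]
    _ = (Rᴴ * (ρ * R * _root_.traceDual N ξ X)).trace := by
        rw [← h, ← trace_mul_traceDual]
        simp only [mul_assoc]
    _ = _ := by
        rw [Matrix.trace_mul_comm]
        simp only [mul_assoc]

theorem HermitianPreserving.map_conjTranspose {N : ℕ} {ξ : SpinOp N →ₗ[ℂ] SpinOp N}
    (hξ : HermitianPreserving N ξ) (ρ : SpinOp N) : ξ ρᴴ = (ξ ρ)ᴴ := by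
  have h1 : (ρ + ρᴴ).IsHermitian := by
    simp [Matrix.IsHermitian, add_comm]
  have h2 : (Complex.I • (ρ - ρᴴ)).IsHermitian := by
    simp [Matrix.IsHermitian, Matrix.conjTranspose_smul, ← smul_neg]
  have e1 := (hξ _ h1).eq
  have e2 := (hξ _ h2).eq
  rw [map_add, Matrix.conjTranspose_add] at e1
  rw [map_smul, map_sub, Matrix.conjTranspose_smul, Matrix.conjTranspose_sub, RCLike.star_def,
    Complex.conj_I, neg_smul, ← smul_neg] at e2
  have e3 := smul_right_injective _ Complex.I_ne_zero e2
  have e4 : (2 : ℂ) • ξ ρᴴ = (2 : ℂ) • (ξ ρ)ᴴ := by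
    rw [two_smul, two_smul]
    have e5 : (ξ ρ)ᴴ + (ξ ρᴴ)ᴴ + ((ξ ρ)ᴴ - (ξ ρᴴ)ᴴ) = ξ ρ + ξ ρᴴ + -(ξ ρ - ξ ρᴴ) := by
      rw [e1, ← e3, neg_neg]
    rw [add_add_sub_cancel, neg_sub, add_comm (ξ ρ), add_add_sub_cancel] at e5
    exact e5.symm
  exact smul_right_injective _ two_ne_zero e4

theorem HermitianPreserving.traceDual {N : ℕ} {ξ : SpinOp N →ₗ[ℂ] SpinOp N}
    (hξ : HermitianPreserving N ξ) : HermitianPreserving N (traceDual N ξ) := by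
  intro X hX
  refine Matrix.ext_iff_trace_mul_left.2 fun ρ => ?_
  calc (ρ * (_root_.traceDual N ξ X)ᴴ).trace
      = star (ρᴴ * _root_.traceDual N ξ X).trace := by
        rw [← Matrix.trace_conjTranspose, Matrix.conjTranspose_mul,
          Matrix.conjTranspose_conjTranspose, Matrix.trace_mul_comm]
    _ = star ((ξ ρ)ᴴ * X).trace := by rw [trace_mul_traceDual, hξ.map_conjTranspose]
    _ = (ξ ρ * X).trace := by
        rw [← Matrix.trace_conjTranspose, Matrix.conjTranspose_mul,
          Matrix.conjTranspose_conjTranspose, hX.eq, Matrix.trace_mul_comm]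
    _ = _ := (trace_mul_traceDual ξ ρ X).symm

open scoped Matrix.Norms.Operator in
/-- Infinitesimal rotational invariance: the derivative at `θ = 0` of the invariance under the
rotations around `n`. -/
theorem RotationallyInvariant.map_commutator {N : ℕ} {ξ : SpinOp N →ₗ[ℂ] SpinOp N}
    (hξ : RotationallyInvariant N ξ) {n : EuclideanSpace ℝ (Fin 3)} (hn : ‖n‖ = 1) (X : SpinOp N) :
    ξ (spinAlong N n * X - X * spinAlong N n) = spinAlong N n * ξ X - ξ X * spinAlong N n := by
  set A : SpinOp N := (-Complex.I) • spinAlong N n with hA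
  have h1 := hasDerivAt_exp_smul_mul_mul_exp_neg_smul A X
  have h2 := hasDerivAt_exp_smul_mul_mul_exp_neg_smul A (ξ X)
  have h3 := (LinearMap.toContinuousLinearMap (ξ.restrictScalars ℝ)).hasFDerivAt.comp_hasDerivAt
    (0 : ℝ) h1
  have hfun : ∀ t : ℝ, NormedSpace.exp (t • A) * ξ X * NormedSpace.exp (-(t • A))
      = ξ (NormedSpace.exp (t • A) * X * NormedSpace.exp (-(t • A))) := by
    intro t
    have h := hξ n hn t X
    rw [conjTranspose_spinRotation, spinRotation_eq_exp_smul] at h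
    exact h.symm
  have h4 : ξ (A * X - X * A) = A * ξ X - ξ X * A :=
    (h3.congr_of_eventuallyEq (Filter.Eventually.of_forall hfun)).unique h2
  simp only [hA, smul_mul_assoc, mul_smul_comm, ← smul_sub, map_smul] at h4
  exact smul_right_injective _ (neg_ne_zero.2 Complex.I_ne_zero) h4

attribute [local instance] LieRing.ofAssociativeRing LieAlgebra.ofAssociativeAlgebra

/-- A rotationally invariant map commutes with `[J_z, ·]`. -/
theorem RotationallyInvariant.commute_ad_spinZ {N : ℕ} {ξ : SpinOp N →ₗ[ℂ] SpinOp N}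
    (hξ : RotationallyInvariant N ξ) : Commute ξ (LieAlgebra.ad ℂ (SpinOp N) (spinZ N)) := by
  have hz : spinAlong N (EuclideanSpace.single 2 1) = spinZ N := by simp [spinAlong]
  refine LinearMap.ext fun X => ?_
  have h := hξ.map_commutator (n := EuclideanSpace.single 2 1) (by simp) X
  rwa [hz] at h

/-- A rotationally invariant map commutes with `[J_+, ·]`, where `J_+ = J_x + i J_y`. -/
theorem RotationallyInvariant.commute_ad_spinRaise {N : ℕ} {ξ : SpinOp N →ₗ[ℂ] SpinOp N}
    (hξ : RotationallyInvariant N ξ) : Commute ξ (LieAlgebra.ad ℂ (SpinOp N) (spinRaise N)) := by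
  have hx : spinAlong N (EuclideanSpace.single 0 1) = spinX N := by simp [spinAlong]
  have hy : spinAlong N (EuclideanSpace.single 1 1) = spinY N := by simp [spinAlong]
  have cx : Commute ξ (LieAlgebra.ad ℂ (SpinOp N) (spinX N)) := by
    refine LinearMap.ext fun X => ?_
    have h := hξ.map_commutator (n := EuclideanSpace.single 0 1) (by simp) X
    rwa [hx] at h
  have cy : Commute ξ (LieAlgebra.ad ℂ (SpinOp N) (spinY N)) := by
    refine LinearMap.ext fun X => ?_
    have h := hξ.map_commutator (n := EuclideanSpace.single 1 1) (by simp) X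
    rwa [hy] at h
  rw [← spinX_add_I_smul_spinY, map_add, map_smul]
  exact cx.add_right (cy.smul_right _)

/-! ### The image of a power of `J_z` -/

/-- On diagonal operators, `[J_+, ·]` acts as a forward difference. -/
theorem ad_spinRaise_pow_diagonal (N : ℕ) (f : ℕ → ℂ) (k : ℕ) :
    (LieAlgebra.ad ℂ (SpinOp N) (spinRaise N) ^ k) (Matrix.diagonal fun a => f a)
      = (Matrix.diagonal fun a : Fin (N + 1) => (fwdDiff 1)^[k] f a) * spinRaise N ^ k := by
  have hcomm : ∀ g : ℕ → ℂ, spinRaise N * (Matrix.diagonal fun a : Fin (N + 1) => g a)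
      - (Matrix.diagonal fun a : Fin (N + 1) => g a) * spinRaise N
      = (Matrix.diagonal fun a : Fin (N + 1) => fwdDiff 1 g a) * spinRaise N := by
    intro g
    ext a b
    rw [Matrix.sub_apply, Matrix.mul_diagonal, Matrix.diagonal_mul, Matrix.diagonal_mul,
      spinRaise_apply]
    split_ifs with h
    · rw [← h, fwdDiff]
      ring
    · simp
  induction k with
  | zero => simp
  | succ k ih =>
    rw [pow_succ', Module.End.mul_apply, ih, LieAlgebra.ad_apply, Ring.lie_def,
      Function.iterate_succ_apply', mul_assoc _ (spinRaise N ^ k), ← pow_succ, pow_succ',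
      ← mul_assoc, ← mul_assoc, ← sub_mul, hcomm, mul_assoc]

theorem spinRaise_pow_apply_ne_zero (N k : ℕ) (a b : Fin (N + 1)) (h : (a : ℕ) + k = b) :
    (spinRaise N ^ k) a b ≠ 0 := by
  induction k generalizing a with
  | zero =>
    have : a = b := Fin.ext (by omega)
    simp [this]
  | succ k ih =>
    rw [pow_succ', Matrix.mul_apply, Finset.sum_eq_single (⟨a + 1, by omega⟩ : Fin (N + 1))]
    · refine mul_ne_zero ?_ (ih _ (by simp only; omega))
      have ha : ((a : ℕ) : ℝ) < N := by exact_mod_cast (by omega : (a : ℕ) < N)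
      rw [spinRaise_apply, if_pos rfl, Complex.ofReal_ne_zero]
      exact (Real.sqrt_pos.2 (mul_pos (by positivity) (sub_pos.2 ha))).ne'
    · intro c _ hc
      rw [spinRaise_apply, if_neg (fun h => hc (Fin.ext h.symm)), zero_mul]
    · simp

theorem eq_diagonal_of_commute_spinZ {N : ℕ} {Y : SpinOp N}
    (h : spinZ N * Y - Y * spinZ N = 0) : Y = Matrix.diagonal fun a => Y a a := by
  ext a b
  rw [Matrix.diagonal_apply]
  split_ifs with hab
  · rw [hab]
  · have h' := congrFun (congrFun h a) b
    rw [spinZ, Matrix.sub_apply, Matrix.diagonal_mul, Matrix.mul_diagonal, mul_comm, ← mul_sub,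
      Matrix.zero_apply, mul_eq_zero] at h'
    refine h'.resolve_right fun hm => hab (Fin.ext ?_)
    simpa [magneticNumber, sub_eq_zero, eq_comm] using hm

theorem sum_smul_spinZ_pow (N : ℕ) (s : Finset ℕ) (c : ℕ → ℂ) :
    ∑ i ∈ s, c i • spinZ N ^ i
      = Matrix.diagonal fun a => ∑ i ∈ s, c i * (magneticNumber N a : ℂ) ^ i := by
  ext a b
  rw [Matrix.sum_apply, Matrix.diagonal_apply]
  split_ifs with h
  · simp [spinZ, Matrix.diagonal_pow, h]
  · exact Finset.sum_eq_zero fun i _ => by simp [spinZ, Matrix.diagonal_pow, h]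

/-- A rotationally invariant map sends `J_z ^ ℓ` to a polynomial in `J_z` of degree at most `ℓ`:
the image commutes with `J_z`, so it is a function of `J_z`, and `[J_+, ·] ^ (ℓ + 1)` annihilates
it as it annihilates `J_z ^ ℓ`. -/
theorem RotationallyInvariant.exists_map_spinZ_pow {N : ℕ} {ξ : SpinOp N →ₗ[ℂ] SpinOp N}
    (hξ : RotationallyInvariant N ξ) (ℓ : ℕ) :
    ∃ c : ℕ → ℂ, ξ (spinZ N ^ ℓ) = ∑ i ∈ Finset.range (ℓ + 1), c i • spinZ N ^ i := by
  set Y := ξ (spinZ N ^ ℓ) with hY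
  have hdiag : Y = Matrix.diagonal fun a => Y a a := by
    refine eq_diagonal_of_commute_spinZ ?_
    have h := LinearMap.congr_fun hξ.commute_ad_spinZ.eq (spinZ N ^ ℓ)
    simp only [Module.End.mul_apply, LieAlgebra.ad_apply, Ring.lie_def] at h
    rw [← hY, ← pow_succ', ← pow_succ, sub_self, map_zero] at h
    exact h.symm
  -- the values outside `{0, …, N}` are irrelevant
  obtain ⟨f, hf⟩ : ∃ f : ℕ → ℂ, ∀ a : Fin (N + 1), Y a a = f a :=
    ⟨fun k => if h : k < N + 1 then Y ⟨k, h⟩ ⟨k, h⟩ else 0, fun a => by simp only [a.isLt, dif_pos]⟩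
  simp only [hf] at hdiag
  have hzpow : spinZ N ^ ℓ = Matrix.diagonal fun a : Fin (N + 1) =>
      (fun k : ℕ => ((N : ℂ) / 2 - k) ^ ℓ) a := by
    rw [spinZ, Matrix.diagonal_pow]
    congr 1
    ext a
    simp [magneticNumber]
  have hzero : (LieAlgebra.ad ℂ (SpinOp N) (spinRaise N) ^ (ℓ + 1)) (spinZ N ^ ℓ) = 0 := by
    rw [hzpow, ad_spinRaise_pow_diagonal N fun k : ℕ => ((N : ℂ) / 2 - k) ^ ℓ,
      fwdDiff_iter_natCast_pow_eq_zero]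
    simp
  have hzero' : (LieAlgebra.ad ℂ (SpinOp N) (spinRaise N) ^ (ℓ + 1)) Y = 0 := by
    have h := LinearMap.congr_fun (hξ.commute_ad_spinRaise.pow_right (ℓ + 1)).eq (spinZ N ^ ℓ)
    simp only [Module.End.mul_apply] at h
    rw [hzero, map_zero] at h
    exact h.symm
  obtain ⟨p, hp, hpf⟩ := exists_polynomial_of_fwdDiff_iter_eq_zero N ℓ ((N : ℂ) / 2) f (by
    intro k hk hkN
    obtain ⟨r, rfl⟩ := Nat.exists_eq_add_of_le' (Nat.succ_le_of_lt hk)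
    have h : (LieAlgebra.ad ℂ (SpinOp N) (spinRaise N) ^ (r + (ℓ + 1))) Y = 0 := by
      rw [pow_add, Module.End.mul_apply, hzero', map_zero]
    rw [hdiag, ad_spinRaise_pow_diagonal] at h
    have h0 := congrFun (congrFun h 0) (⟨r + (ℓ + 1), by omega⟩ : Fin (N + 1))
    rw [Matrix.diagonal_mul, Matrix.zero_apply, mul_eq_zero] at h0
    exact h0.resolve_right (spinRaise_pow_apply_ne_zero N _ _ _ (by simp)))
  refine ⟨p.coeff, ?_⟩
  rw [hdiag, sum_smul_spinZ_pow]
  congr 1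
  ext a
  rw [hpf a (by omega), Polynomial.eval_eq_sum_range' hp]
  simp [magneticNumber]

/-- The coefficients may be taken real if the image of `J_z ^ ℓ` is Hermitian, because the
eigenvalues of `J_z` are real. -/
theorem eq_sum_re_smul_spinZ_pow {N : ℕ} {Y : SpinOp N} (hY : Y.IsHermitian) {s : Finset ℕ}
    {c : ℕ → ℂ} (h : Y = ∑ i ∈ s, c i • spinZ N ^ i) :
    Y = ∑ i ∈ s, ((c i).re : ℂ) • spinZ N ^ i := by
  rw [sum_smul_spinZ_pow] at h ⊢
  nth_rewrite 1 [h]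
  congr 1
  ext a
  have h1 : Y a a = ∑ i ∈ s, c i * (magneticNumber N a : ℂ) ^ i := by
    nth_rewrite 1 [h]
    rw [Matrix.diagonal_apply_eq]
  have h2 : ((Y a a).re : ℂ) = Y a a := hY.coe_re_apply_self a
  rw [← h1, ← h2, h1, Complex.re_sum]
  push_cast
  refine Finset.sum_congr rfl fun i _ => ?_
  rw [← Complex.ofReal_pow, Complex.re_mul_ofReal]
  push_cast
  rfl

theorem RotationallyInvariant.map_spinAlong_pow {N : ℕ} {ξ : SpinOp N →ₗ[ℂ] SpinOp N}
    (hξ : RotationallyInvariant N ξ) {ℓ : ℕ} {s : Finset ℕ} {c : ℕ → ℂ}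
    (h : ξ (spinZ N ^ ℓ) = ∑ i ∈ s, c i • spinZ N ^ i) {n : EuclideanSpace ℝ (Fin 3)}
    (hn : ‖n‖ = 1) : ξ (spinAlong N n ^ ℓ) = ∑ i ∈ s, c i • spinAlong N n ^ i := by
  obtain ⟨m, θ, hm, hR⟩ := exists_spinRotation_mul_spinZ_eq_spinAlong N n hn
  have hinv := conjTranspose_mul_spinRotation N m θ
  have hinv' := mul_eq_one_comm.1 hinv
  have hpow : ∀ i, spinAlong N n ^ i
      = spinRotation N m θ * spinZ N ^ i * (spinRotation N m θ)ᴴ := by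
    intro i
    rw [← hR]
    induction i with
    | zero => simp [hinv']
    | succ i ih =>
      rw [pow_succ, ih, pow_succ]
      calc _ = spinRotation N m θ * spinZ N ^ i * ((spinRotation N m θ)ᴴ * spinRotation N m θ)
            * spinZ N * (spinRotation N m θ)ᴴ := by simp only [mul_assoc]
        _ = _ := by
          rw [hinv]
          simp only [mul_assoc, one_mul]
  simp only [hpow]
  rw [hξ m hm, h, Finset.mul_sum, Finset.sum_mul]
  simp only [mul_smul_comm, smul_mul_assoc]

/-- Only the powers of the parity of `ℓ` are needed, because a rotation takes `J_z` to `-J_z`. -/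
theorem RotationallyInvariant.map_spinZ_pow_parity {N : ℕ} {ξ : SpinOp N →ₗ[ℂ] SpinOp N}
    (hξ : RotationallyInvariant N ξ) {ℓ : ℕ} {s : Finset ℕ} {c : ℕ → ℂ}
    (h : ξ (spinZ N ^ ℓ) = ∑ i ∈ s, c i • spinZ N ^ i) :
    ξ (spinZ N ^ ℓ) = ∑ i ∈ s, (if Even (i + ℓ) then c i else 0) • spinZ N ^ i := by
  have hz : spinAlong N (EuclideanSpace.single 2 (-1)) = -spinZ N := by simp [spinAlong]
  have h1 := hξ.map_spinAlong_pow h (n := EuclideanSpace.single 2 (-1)) (by simp)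
  have hneg : ∀ i, (-spinZ N) ^ i = ((-1 : ℂ) ^ i) • spinZ N ^ i := fun i => by
    rw [← neg_one_smul ℂ, smul_pow]
  simp only [hz, hneg, map_smul, smul_smul] at h1
  have h2 : ξ (spinZ N ^ ℓ) = ∑ i ∈ s, (c i * (-1) ^ (i + ℓ)) • spinZ N ^ i := by
    calc ξ (spinZ N ^ ℓ) = ((-1 : ℂ) ^ ℓ) • ((-1 : ℂ) ^ ℓ) • ξ (spinZ N ^ ℓ) := by
          rw [smul_smul, ← mul_pow]
          simp
      _ = _ := by
          rw [h1, Finset.smul_sum]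
          refine Finset.sum_congr rfl fun i _ => ?_
          rw [smul_smul, pow_add]
          congr 1
          ring
  calc ξ (spinZ N ^ ℓ) = (1 / 2 : ℂ) • (ξ (spinZ N ^ ℓ) + ξ (spinZ N ^ ℓ)) := by module
    _ = _ := by
      nth_rewrite 1 [h]
      rw [h2, ← Finset.sum_add_distrib, Finset.smul_sum]
      refine Finset.sum_congr rfl fun i _ => ?_
      rw [← add_smul, smul_smul]
      congr 1
      split_ifs with hi
      · rw [hi.neg_one_pow]
        ring
      · rw [(Nat.not_even_iff_odd.1 hi).neg_one_pow]
        ring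

theorem exists_parity_coefficients {N : ℕ} {ξ : SpinOp N →ₗ[ℂ] SpinOp N}
    (hξ : RotationallyInvariant N ξ) (ℓ : ℕ) :
    ∃ c : ℕ → ℂ, (HermitianPreserving N ξ → ∀ i, (c i).im = 0) ∧
      (∀ i, ¬ Even (i + ℓ) → c i = 0) ∧
      ∀ n : EuclideanSpace ℝ (Fin 3), ‖n‖ = 1 →
        ξ (spinAlong N n ^ ℓ) = ∑ i ∈ Finset.range (ℓ + 1), c i • spinAlong N n ^ i := by
  obtain ⟨c, hreal, hc⟩ : ∃ c : ℕ → ℂ, (HermitianPreserving N ξ → ∀ i, (c i).im = 0) ∧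
      ξ (spinZ N ^ ℓ) = ∑ i ∈ Finset.range (ℓ + 1), c i • spinZ N ^ i := by
    obtain ⟨c, hc⟩ := hξ.exists_map_spinZ_pow ℓ
    by_cases hH : HermitianPreserving N ξ
    · exact ⟨fun i => (c i).re, fun _ i => Complex.ofReal_im _,
        eq_sum_re_smul_spinZ_pow (hH _ ((isHermitian_spinZ N).pow ℓ)) hc⟩
    · exact ⟨c, fun h => absurd h hH, hc⟩
  refine ⟨fun i => if Even (i + ℓ) then c i else 0, fun hH i => ?_, fun i hi => if_neg hi,
    fun n hn => hξ.map_spinAlong_pow (hξ.map_spinZ_pow_parity hc) hn⟩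
  dsimp only
  split_ifs
  · exact hreal hH i
  · exact Complex.zero_im

/-! ### Moments -/

theorem sum_range_eq_sum_even {M : Type*} [AddCommMonoid M] (g : ℕ → M)
    (hg : ∀ i, ¬ Even i → g i = 0) (r : ℕ) :
    ∑ i ∈ Finset.range (2 * r + 1), g i = ∑ i ∈ Finset.range (r + 1), g (2 * i) := by
  induction r with
  | zero => simp
  | succ r ih =>
    rw [Finset.sum_range_succ _ (r + 1), ← ih, mul_add, mul_one, Finset.sum_range_succ,
      Finset.sum_range_succ _ (2 * r + 1), hg (2 * r + 1) (by simp), add_zero]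

theorem sum_range_eq_sum_odd {M : Type*} [AddCommMonoid M] (g : ℕ → M)
    (hg : ∀ i, Even i → g i = 0) (r : ℕ) :
    ∑ i ∈ Finset.range (2 * r + 2), g i = ∑ i ∈ Finset.Icc 1 (r + 1), g (2 * i - 1) := by
  induction r with
  | zero => simp [Finset.sum_range_succ, hg 0]
  | succ r ih =>
    rw [Finset.sum_Icc_succ_top (by omega), ← ih, mul_add, mul_one, Finset.sum_range_succ,
      Finset.sum_range_succ _ (2 * r + 2), hg (2 * r + 2) (by simp [parity_simps]), add_zero]
    congr 1

theorem theorem2 (N : ℕ) (ξ : SpinOp N →ₗ[ℂ] SpinOp N) (hξ : RotationallyInvariant N ξ) :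
    ∃ A : ℕ → ℕ → ℂ,
      (HermitianPreserving N ξ → ∀ ℓ i : ℕ, (A ℓ i).im = 0) ∧
      ∀ n : EuclideanSpace ℝ (Fin 3), ‖n‖ = 1 →
      ∀ ρ : ℕ → SpinOp N, (∀ k : ℕ, 1 ≤ k → ρ k = ξ (ρ (k - 1))) →
      ∀ k : ℕ, 1 ≤ k → ∀ ℓ : ℕ,
        (Even ℓ → moment N n (ρ k) ℓ
          = ∑ i ∈ Finset.range (ℓ / 2 + 1), A ℓ (2 * i) * moment N n (ρ (k - 1)) (2 * i)) ∧
        (Odd ℓ → moment N n (ρ k) ℓ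
          = ∑ i ∈ Finset.Icc 1 ((ℓ + 1) / 2),
              A ℓ (2 * i - 1) * moment N n (ρ (k - 1)) (2 * i - 1)) := by
  choose A hreal hpar hA using fun ℓ => exists_parity_coefficients hξ.traceDual ℓ
  refine ⟨A, fun hH ℓ => hreal ℓ hH.traceDual, fun n hn ρ hρ k hk ℓ => ?_⟩
  have hmom : moment N n (ρ k) ℓ
      = ∑ i ∈ Finset.range (ℓ + 1), A ℓ i * moment N n (ρ (k - 1)) i := by
    rw [moment, hρ k hk, ← trace_mul_traceDual, hA ℓ n hn, Finset.mul_sum, Matrix.trace_sum]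
    simp only [mul_smul_comm, Matrix.trace_smul, smul_eq_mul, moment]
  refine ⟨fun hℓ => ?_, fun hℓ => ?_⟩
  · obtain ⟨r, rfl⟩ := hℓ.two_dvd
    rw [hmom, Nat.mul_div_cancel_left _ two_pos]
    refine sum_range_eq_sum_even (fun i => A (2 * r) i * moment N n (ρ (k - 1)) i) ?_ r
    intro i hi
    rw [hpar _ i (by simpa [parity_simps] using hi), zero_mul]
  · obtain ⟨r, rfl⟩ := hℓ
    rw [hmom, show (2 * r + 1 + 1) / 2 = r + 1 by omega]
    refine sum_range_eq_sum_odd (fun i => A (2 * r + 1) i * moment N n (ρ (k - 1)) i) ?_ r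
    intro i hi
    rw [hpar _ i (by simpa [parity_simps] using hi), zero_mul]
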